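/- Let $k$ be an algebraically closed field of positive characteristic $p$. Let $\mathbb{G}_a\rtimes\mathbb{G}_m$ be the semidirect product with multiplication $(t_1,z_1)\cdot(t_2,z_2)=(t_1+z_1^2t_2,\;z_1z_2)$, and let $\iota:\mathbb{G}_a\rtimes\mathbb{G}_m\to\mathrm{SL}(2,k)$ be the injective homomorphism $$\iota(t,z)=\begin{pmatrix} z & t z^{-1}\\ 0 & z^{-1}\end{pmatrix},$$ by which $\mathbb{G}_a\rtimes\mathbb{G}_m$ is identified with the group of upper triangular matrices $\begin{pmatrix} a& b\\ 0& d\end{pmatrix}$ in $\mathrm{SL}(2,k)$. A representation means a homomorphism of algebraic groups. A representation $\varphi:\mathbb{G}_a\rtimes\mathbb{G}_m\to\mathrm{SL}(3,k)$ is called fundamental if there is a representation $\psi:\mathrm{SL}(2,k)\to\mathrm{SL}(3,k)$ with $\varphi=\psi\circ\iota$. Two representations $\varphi_1,\varphi_2$ into $\mathrm{SL}(3,k)$ are called equivalent, written $\varphi_1\sim\varphi_2$, if there is $P\in\mathrm{GL}(3,k)$ with $P^{-1}\varphi_1(g)P=\varphi_2(g)$ for all $g$. Consider the following five forms, where $e$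 is an integer $\ge 0$: - (I)$^\sharp$ (only if $p\ge 3$): $\ \varphi\begin{pmatrix} a& b\\ 0& d\end{pmatrix}=\begin{pmatrix} a^{2p^{e}} & a^{p^{e}}b^{p^{e}} & \tfrac12 b^{2p^{e}}\\ 0&1& b^{p^{e}}d^{p^{e}}\\ 0&0&d^{2p^{e}}\end{pmatrix}$ for some $e$; - (IV)$^\sharp$: $\ \varphi\begin{pmatrix} a& b\\ 0& d\end{pmatrix}=\begin{pmatrix} a^{p^{e}} & 0 & b^{p^{e}}\\ 0&1& 0\\ 0&0&d^{p^{e}}\end{pmatrix}$ for some $e$; - (V)$^\sharp$ (only if $p=2$): $\ \varphi\begin{pmatrix} a& b\\ 0& d\end{pmatrix}=\begin{pmatrix} a^{2p^{e}} & a^{p^{e}}b^{p^{e}} & b^{2p^{e}}\\ 0&1& 0\\ 0&0&d^{2p^{e}}\end{pmatrix}$ for some $e$; - (VII)$^\sharp$ (only if $p=2$): $\ \varphi\begin{pmatrix} a& b\\ 0& d\end{pmatrix}=\begin{pmatrix} a^{2p^{e}} & 0 & b^{2p^{e}}\\ 0&1& b^{p^{e}}d^{p^{e}}\\ 0&0&d^{2p^{e}}\end{pmatrix}$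 for some $e$; - (XII)$^\sharp$: $\ \varphi$ is the constant map with value the identity matrix $I_3$. Let $\Lambda^\sharp=\{\mathrm{(I)}^\sharp,\mathrm{(IV)}^\sharp,\mathrm{(V)}^\sharp,\mathrm{(VII)}^\sharp,\mathrm{(XII)}^\sharp\}$ and, for $\lambda\in\Lambda^\sharp$, let $R^\sharp(\lambda)$ be the set of fundamental representations $\varphi:\mathbb{G}_a\rtimes\mathbb{G}_m\to\mathrm{SL}(3,k)$ that have the form $\lambda$. Then the map sending a representation to its equivalence class is a bijection $$\coprod_{\lambda\in\Lambda^\sharp}R^\sharp(\lambda)\;\xrightarrow{\ \cong\ }\;\{\varphi:\mathbb{G}_a\rtimes\mathbb{G}_m\to\mathrm{SL}(3,k)\mid\varphi\text{ is a fundamental representation}\}/\sim.$$ -/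

import Mathlib

open scoped Matrix

namespace GaGmSL3

/-- The action of the multiplicative group on the additive group in which `z` sends `t`
to `z ^ 2 * t`. -/
def gmAction (k : Type*) [Field k] : kˣ →* MulAut (Multiplicative k) where
  toFun z :=
    { toFun := fun t => Multiplicative.ofAdd ((z : k) ^ 2 * t.toAdd)
      invFun := fun t => Multiplicative.ofAdd (((z⁻¹ : kˣ) : k) ^ 2 * t.toAdd)
      left_inv := fun t => by
        apply Multiplicative.toAdd.injective
        simp only [toAdd_ofAdd]
        rw [← mul_assoc, ← mul_pow, Units.inv_mul, one_pow, one_mul]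
      right_inv := fun t => by
        apply Multiplicative.toAdd.injective
        simp only [toAdd_ofAdd]
        rw [← mul_assoc, ← mul_pow, Units.mul_inv, one_pow, one_mul]
      map_mul' := fun s t => by
        apply Multiplicative.toAdd.injective
        simp only [toAdd_ofAdd, toAdd_mul, mul_add] }
  map_one' := by
    ext t
    apply Multiplicative.toAdd.injective
    simp
  map_mul' z w := by
    ext t
    apply Multiplicative.toAdd.injective
    simp [mul_pow, mul_assoc]

/-- The (`k`-points of the) semidirect product of the additive by the multiplicative group, with
`(t₁, z₁) * (t₂, z₂) = (t₁ + z₁ ^ 2 * t₂, z₁ * z₂)`. -/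
abbrev GaGm (k : Type*) [Field k] : Type _ := Multiplicative k ⋊[gmAction k] kˣ

/-- The coordinate `t` of `(t, z)`. -/
def GaGm.t {k : Type*} [Field k] (g : GaGm k) : k := g.left.toAdd

/-- The coordinate `z` of `(t, z)`. -/
def GaGm.z {k : Type*} [Field k] (g : GaGm k) : kˣ := g.right

theorem GaGm.t_mul {k : Type*} [Field k] (g h : GaGm k) :
    (g * h).t = g.t + (g.z : k) ^ 2 * h.t := rfl

theorem GaGm.z_mul {k : Type*} [Field k] (g h : GaGm k) : (g * h).z = g.z * h.z := rfl

theorem GaGm.t_one {k : Type*} [Field k] : (1 : GaGm k).t = 0 := rfl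

theorem GaGm.z_one {k : Type*} [Field k] : (1 : GaGm k).z = 1 := rfl

/-- The upper triangular matrix with rows `(z, t * z⁻¹)` and `(0, z⁻¹)`, where `g = (t, z)`. -/
def borel {k : Type*} [Field k] (g : GaGm k) : Matrix (Fin 2) (Fin 2) k :=
  !![(g.z : k), g.t * (g.z : k)⁻¹; 0, (g.z : k)⁻¹]

theorem det_borel {k : Type*} [Field k] (g : GaGm k) : (borel g).det = 1 := by
  simp [borel, Matrix.det_fin_two_of]

theorem borel_one {k : Type*} [Field k] : borel (1 : GaGm k) = 1 := by
  simp [borel, GaGm.t_one, GaGm.z_one, Matrix.one_fin_two]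

theorem borel_mul {k : Type*} [Field k] (g h : GaGm k) :
    borel (g * h) = borel g * borel h := by
  have hg : (g.z : k) ≠ 0 := g.z.ne_zero
  have hh : (h.z : k) ≠ 0 := h.z.ne_zero
  ext i j
  fin_cases i <;> fin_cases j <;>
    simp [borel, GaGm.t_mul, GaGm.z_mul, Matrix.mul_apply, Fin.sum_univ_two] <;>
    field_simp
  ring

/-- The injective homomorphism into `SL(2, k)` sending `g = (t, z)` to `borel g`. -/
def iota (k : Type*) [Field k] : GaGm k →* Matrix.SpecialLinearGroup (Fin 2) k where
  toFun g := ⟨borel g, det_borel g⟩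
  map_one' := Subtype.ext borel_one
  map_mul' g h := Subtype.ext (borel_mul g h)

/-- The regular functions on `𝔾ₐ ⋊ 𝔾ₘ`, as functions on `k`-points: the polynomials in
`t`, `z`, `z⁻¹`. -/
def regularGaGm (k : Type*) [Field k] : Subalgebra k (GaGm k → k) :=
  Algebra.adjoin k
    {fun g => g.t, fun g => (g.z : k), fun g => (g.z : k)⁻¹}

/-- The regular functions on `SL(m, k)`, as functions on `k`-points: the polynomials in the
matrix entries. -/
def regularSL (m : ℕ) (k : Type*) [Field k] :
    Subalgebra k (Matrix.SpecialLinearGroup (Fin m) k → k) :=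
  Algebra.adjoin k
    (Set.range fun (ij : Fin m × Fin m) (g : Matrix.SpecialLinearGroup (Fin m) k) =>
      (g : Matrix (Fin m) (Fin m) k) ij.1 ij.2)

/-- A representation, as an algebraic group, of `G` into `SL(n, k)`: a group homomorphism whose
matrix entries are regular functions, where `A` is the algebra of regular functions on `G`. (Over
an algebraically closed field and for reduced `G`, this is a homomorphism of algebraic groups.) -/
@[ext]
structure AlgRep {k : Type*} [Field k] {G : Type*} [Group G] (A : Subalgebra k (G → k))
    (n : ℕ) where
  toHom : G →* Matrix.SpecialLinearGroup (Fin n) k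
  regular : ∀ i j : Fin n, (fun g => (toHom g : Matrix (Fin n) (Fin n) k) i j) ∈ A

/-- Equivalence of representations into `SL(n, k)`: conjugation by a matrix of `GL(n, k)`. -/
def AlgRep.Equivalent {k : Type*} [Field k] {G : Type*} [Group G] {A : Subalgebra k (G → k)}
    {n : ℕ} (ρ₁ ρ₂ : AlgRep A n) : Prop :=
  ∃ P : Matrix.GeneralLinearGroup (Fin n) k, ∀ g : G,
    ((P⁻¹ : Matrix.GeneralLinearGroup (Fin n) k) : Matrix (Fin n) (Fin n) k) *
      (ρ₁.toHom g : Matrix (Fin n) (Fin n) k) * (P : Matrix (Fin n) (Fin n) k) =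
      (ρ₂.toHom g : Matrix (Fin n) (Fin n) k)

theorem AlgRep.equivalent_equivalence {k : Type*} [Field k] {G : Type*} [Group G]
    (A : Subalgebra k (G → k)) (n : ℕ) :
    Equivalence (AlgRep.Equivalent : AlgRep A n → AlgRep A n → Prop) where
  refl ρ := ⟨1, fun g => by simp⟩
  symm := by
    rintro ρ₁ ρ₂ ⟨P, hP⟩
    refine ⟨P⁻¹, fun g => ?_⟩
    rw [← hP g, inv_inv]
    simp only [mul_assoc, Units.mul_inv, mul_one]
    rw [← mul_assoc, Units.mul_inv, one_mul]
  trans := by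
    rintro ρ₁ ρ₂ ρ₃ ⟨P, hP⟩ ⟨Q, hQ⟩
    refine ⟨P * Q, fun g => ?_⟩
    rw [← hQ g, ← hP g, mul_inv_rev]
    simp only [Units.val_mul, mul_assoc]

/-- A representation of `𝔾ₐ ⋊ 𝔾ₘ` into `SL(n, k)` is fundamental if it extends along `iota` to a
representation of `SL(2, k)`. -/
def IsFundamental {k : Type*} [Field k] {n : ℕ} (φ : AlgRep (regularGaGm k) n) : Prop :=
  ∃ ψ : AlgRep (regularSL 2 k) n, φ.toHom = ψ.toHom.comp (iota k)

/-- Equivalence, on the set of fundamental representations. -/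
def fundamentalSetoid (k : Type*) [Field k] (n : ℕ) :
    Setoid {φ : AlgRep (regularGaGm k) n // IsFundamental φ} where
  r φ φ' := φ.1.Equivalent φ'.1
  iseqv :=
    { refl := fun φ => (AlgRep.equivalent_equivalence _ _).refl φ.1
      symm := fun h => (AlgRep.equivalent_equivalence _ _).symm h
      trans := fun h h' => (AlgRep.equivalent_equivalence _ _).trans h h' }

/-- The labels of the five forms. -/
inductive SharpForm
  | I
  | IV
  | V
  | VII
  | XII

/-- `φ` has the given form. Here `a`, `b`, `d` are the entries of the upper triangular matrix with
rows `(a, b)` and `(0, d)` that corresponds to an element of `𝔾ₐ ⋊ 𝔾ₘ`, and `p` is the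
characteristic of `k`. -/
def HasSharpForm {k : Type*} [Field k] (p : ℕ) (φ : AlgRep (regularGaGm k) 3) :
    SharpForm → Prop
  | .I => 3 ≤ p ∧ ∃ e : ℕ, ∀ g : GaGm k,
      let a := borel g 0 0
      let b := borel g 0 1
      let d := borel g 1 1
      (φ.toHom g : Matrix (Fin 3) (Fin 3) k) =
        !![a ^ (2 * p ^ e), a ^ p ^ e * b ^ p ^ e, 1 / 2 * b ^ (2 * p ^ e);
           0, 1, b ^ p ^ e * d ^ p ^ e;
           0, 0, d ^ (2 * p ^ e)]
  | .IV => ∃ e : ℕ, ∀ g : GaGm k,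
      let a := borel g 0 0
      let b := borel g 0 1
      let d := borel g 1 1
      (φ.toHom g : Matrix (Fin 3) (Fin 3) k) =
        !![a ^ p ^ e, 0, b ^ p ^ e;
           0, 1, 0;
           0, 0, d ^ p ^ e]
  | .V => p = 2 ∧ ∃ e : ℕ, ∀ g : GaGm k,
      let a := borel g 0 0
      let b := borel g 0 1
      let d := borel g 1 1
      (φ.toHom g : Matrix (Fin 3) (Fin 3) k) =
        !![a ^ (2 * p ^ e), a ^ p ^ e * b ^ p ^ e, b ^ (2 * p ^ e);
           0, 1, 0;
           0, 0, d ^ (2 * p ^ e)]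
  | .VII => p = 2 ∧ ∃ e : ℕ, ∀ g : GaGm k,
      let a := borel g 0 0
      let b := borel g 0 1
      let d := borel g 1 1
      (φ.toHom g : Matrix (Fin 3) (Fin 3) k) =
        !![a ^ (2 * p ^ e), 0, b ^ (2 * p ^ e);
           0, 1, b ^ p ^ e * d ^ p ^ e;
           0, 0, d ^ (2 * p ^ e)]
  | .XII => ∀ g : GaGm k,
      (φ.toHom g : Matrix (Fin 3) (Fin 3) k) =
        !![1, 0, 0;
           0, 1, 0;
           0, 0, 1]

/-- The set of fundamental representations with the form `lam`. -/
def RSharp (k : Type*) [Field k] (p : ℕ) (lam : SharpForm) :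
    Set (AlgRep (regularGaGm k) 3) :=
  {φ | IsFundamental φ ∧ HasSharpForm p φ lam}

/-- The natural map from the disjoint union of the sets `RSharp k p lam` to the set of equivalence
classes of fundamental representations, sending a representation to its class. -/
def sharpToClass (k : Type*) [Field k] (p : ℕ) (x : Σ lam : SharpForm, RSharp k p lam) :
    Quotient (fundamentalSetoid k 3) :=
  Quotient.mk (fundamentalSetoid k 3) ⟨x.2.1, x.2.2.1⟩

end GaGmSL3

open scoped Matrix

namespace GaGmSL3

/-! Surjectivity is weight theory for an extension `ψ` to `SL(2, k)`. The torus acts diagonalizably,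
and its weights have sum zero (determinant one) and are closed under negation (Weyl element), so up
to order they are `m, 0, -m`. Torus equivariance makes each entry of the image of the unipotent
subgroup a monomial in `t` (`upper_apply`), leaving a unitriangular matrix with entries `α t^n`, `γ
t^n`, `β t^m`, where `m = 2n` if `α` or `γ` is nonzero.

Two constraints remain. Additivity in `t` forces the exponents to be powers of `p` (up to the factor
2) and gives `2β = αγ` unless `α = γ = 0` (`upper_relations`). A relation between the Weyl element
and the unipotents excludes `β = αγ = 0` (`mul_ne_zero_or_ne_zero`); this is where being
fundamental, and not merely a representation of the Borel subgroup, matters. The vanishing pattern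
of `(α, γ)` then selects (I), (IV), (V) or (VII), with (XII) for `m = 0`, and a diagonal conjugation
normalizes the coefficients (`HasShape.exists_sharp`).

Injectivity uses two invariants of the equivalence class: `m`, read off from the trace on the torus,
and, for `m ≠ 0`, the vanishing pattern of `(α, γ)`, since an intertwiner commutes with a torus of
distinct weights and is diagonal. Together they determine the form and its exponent. -/

/-! ### Power functions and polynomial identities over an infinite field -/

theorem eq_of_zpow_eq {k : Type*} [Field k] [Infinite k] {m n : ℤ}
    (h : ∀ z : kˣ, (z : k) ^ m = (z : k) ^ n) : m = n := by
  have key : ∀ d : ℕ, (∀ z : kˣ, (z : k) ^ d = 1) → d = 0 := by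
    intro d hd
    by_contra hd0
    -- The extra factor `X` makes the polynomial vanish at `0` as well, so that it vanishes on all
    -- of `k`.
    have : (Polynomial.X * (Polynomial.X ^ d - 1) : Polynomial k) = 0 := by
      apply Polynomial.funext
      intro r
      by_cases hr : r = 0
      · simp [hr]
      · simpa [hr, sub_eq_zero] using hd (Units.mk0 r hr)
    rcases mul_eq_zero.1 this with h0 | h0
    · exact Polynomial.X_ne_zero h0
    · exact (Polynomial.monic_X_pow_sub_C (1 : k) hd0).ne_zero (by simpa using h0)
  have aux : ∀ z : kˣ, z ^ (m - n) = 1 := fun z => by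
    have := h z
    ext
    rw [zpow_sub, Units.val_mul, ← zpow_neg]
    push_cast
    rw [this, zpow_neg, mul_inv_cancel₀ (zpow_ne_zero _ z.ne_zero)]
  have := key (m - n).natAbs (fun z => by
    rcases Int.natAbs_eq (m - n) with h' | h'
    · have := aux z
      rw [h', zpow_natCast] at this
      rw [← Units.val_pow_eq_pow_val, this, Units.val_one]
    · have := aux z
      rw [h', zpow_neg, zpow_natCast, inv_eq_one] at this
      rw [← Units.val_pow_eq_pow_val, this, Units.val_one])
  omega

/-- The characters `z ↦ z ^ n` of the multiplicative group, as functions, are linearly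
independent. -/
theorem linearIndependent_zpow (k : Type*) [Field k] [Infinite k] :
    LinearIndependent k (fun (n : ℤ) (z : kˣ) => (z : k) ^ n) := by
  let χ : ℤ → (kˣ →* k) := fun n => (Units.coeHom k).comp (zpowGroupHom n)
  have hχ : Function.Injective χ := fun m n h => by
    apply eq_of_zpow_eq (k := k)
    intro z
    simpa [χ] using DFunLike.congr_fun h z
  have := (linearIndependent_monoidHom kˣ k).comp χ hχ
  have e : (fun (n : ℤ) (z : kˣ) => (z : k) ^ n) = (fun f : kˣ →* k => (f : kˣ → k)) ∘ χ := by
    ext n z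
    simp [χ]
  rw [e]
  exact this

/-- A polynomial whose values are multiplied by `z ^ d` when the variable is multiplied by `z ^ 2`
is a monomial. -/
theorem eval_eq_of_homogeneous {k : Type*} [Field k] [Infinite k] (P : Polynomial k) (d : ℤ)
    (h : ∀ (z : kˣ) (t : k), P.eval ((z : k) ^ 2 * t) = (z : k) ^ d * P.eval t) :
    (∃ n : ℕ, (2 * n : ℤ) = d ∧ ∃ c, c ≠ 0 ∧ ∀ t, P.eval t = c * t ^ n) ∨ ∀ t, P.eval t = 0 := by
  -- Comparing coefficients of `P(z² X)` and `z^d P(X)` leaves at most one degree in the support of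
  -- `P`.
  have hc : ∀ n, P.coeff n ≠ 0 → (2 * n : ℤ) = d := by
    intro n hn
    apply eq_of_zpow_eq (k := k)
    intro z
    have hP : P.comp (Polynomial.C ((z : k) ^ 2) * Polynomial.X) =
        Polynomial.C ((z : k) ^ d) * P := by
      apply Polynomial.funext
      intro t
      simpa using h z t
    have := congrArg (fun Q => Q.coeff n) hP
    simp only [Polynomial.comp_C_mul_X_coeff, Polynomial.coeff_C_mul] at this
    rw [mul_comm] at this
    rw [← mul_right_cancel₀ hn this, ← pow_mul]
    norm_cast
  by_cases hP : P = 0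
  · right; simp [hP]
  · left
    have hn := Polynomial.leadingCoeff_ne_zero.2 hP
    refine ⟨P.natDegree, hc _ hn, P.leadingCoeff, hn, fun t => ?_⟩
    rw [Polynomial.eval_eq_sum, Polynomial.sum_def, Finset.sum_eq_single P.natDegree]
    · rfl
    · intro b hb hb'
      have := hc _ (Polynomial.mem_support_iff.1 hb)
      have := hc _ hn
      omega
    · intro h'
      simp [Polynomial.notMem_support_iff.1 h']

/-- In characteristic `p`, the additive monomials are the `X ^ p ^ e`. -/
theorem exists_eq_pow_of_add_pow {k : Type*} [Field k] [IsAlgClosed k] (p : ℕ) [Fact p.Prime]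
    [CharP k p] {n : ℕ} (hn : n ≠ 0) (h : ∀ s t : k, (s + t) ^ n = s ^ n + t ^ n) :
    ∃ e, n = p ^ e := by
  obtain ⟨e, r, hr, rfl⟩ := Nat.exists_eq_pow_mul_and_not_dvd hn p (Fact.out : p.Prime).ne_one
  refine ⟨e, ?_⟩
  have hp : p ^ e ≠ 0 := pow_ne_zero _ (Fact.out : p.Prime).ne_zero
  -- Frobenius is additive and, `k` being algebraically closed, surjective, so the factor `p ^ e`
  -- can be stripped from the exponent.
  have hpoly : ((1 + Polynomial.X) ^ r : Polynomial k) = 1 + Polynomial.X ^ r := by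
    apply Polynomial.funext
    intro x
    obtain ⟨y, rfl⟩ := IsAlgClosed.exists_pow_nat_eq x (Nat.pos_of_ne_zero hp)
    have := h 1 y
    rw [pow_mul, add_pow_char_pow] at this
    simpa [pow_mul] using this
  -- At `0` the left derivative is `r`, which is nonzero in `k`, while the right one vanishes unless
  -- `r = 1`.
  have hd := congrArg (fun Q => (Polynomial.derivative Q).eval 0) hpoly
  have hr0 : (r : k) ≠ 0 := fun h0 => hr ((CharP.cast_eq_zero_iff k p r).1 h0)
  by_cases h1 : r = 1
  · simp [h1]
  · have : r - 1 ≠ 0 := by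
      have : r ≠ 0 := by rintro rfl; simp at hr
      omega
    simp [Polynomial.derivative_pow, this] at hd
    exact absurd hd hr0

/-- After clearing denominators the difference of the two sides is `(z^m - z^n)(z^(m+n) - 1)`, and
the second factor is the zero polynomial only for `m = n = 0`. This recovers `m` from the trace of
the torus. -/
theorem eq_of_add_inv_pow_eq {k : Type*} [Field k] [Infinite k] {m n : ℕ}
    (h : ∀ z : kˣ, (z : k) ^ m + ((z : k)⁻¹) ^ m = (z : k) ^ n + ((z : k)⁻¹) ^ n) : m = n := by
  have : ((Polynomial.X ^ m - Polynomial.X ^ n) *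
      (Polynomial.X * (Polynomial.X ^ (m + n) - 1)) : Polynomial k) = 0 := by
    apply Polynomial.funext
    intro r
    by_cases hr : r = 0
    · simp [hr]
    · have := h (Units.mk0 r hr)
      simp only [Units.val_mk0, inv_pow] at this
      field_simp at this
      simp only [Polynomial.eval_mul, Polynomial.eval_sub, Polynomial.eval_pow,
        Polynomial.eval_X, Polynomial.eval_one, Polynomial.eval_zero]
      have h2 : (r ^ m - r ^ n) * (r ^ (m + n) - 1) = 0 := by
        ring_nf at this ⊢
        linear_combination this
      linear_combination r * h2
  rcases mul_eq_zero.1 this with h0 | h0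
  · have := congrArg Polynomial.natDegree (sub_eq_zero.1 h0)
    simpa using this
  · rcases mul_eq_zero.1 h0 with h0 | h0
    · exact absurd h0 Polynomial.X_ne_zero
    · by_contra hmn
      exact (Polynomial.monic_X_pow_sub_C (1 : k) (n := m + n) (by omega)).ne_zero
        (by simpa using h0)

/-! ### Regular functions pulled back to the torus and the additive group -/

/-- The functions on `kˣ` that are Laurent polynomials. -/
def laurentFunctions (k : Type*) [Field k] : Subalgebra k (kˣ → k) :=
  (Submodule.span k (Set.range fun (n : ℤ) (z : kˣ) => (z : k) ^ n)).toSubalgebra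
    (Submodule.subset_span ⟨0, by ext; simp⟩) (by
      intro f g hf hg
      have := Submodule.mul_mem_mul hf hg
      rw [Submodule.span_mul_span] at this
      refine Submodule.span_mono ?_ this
      rintro _ ⟨_, ⟨m, rfl⟩, _, ⟨n, rfl⟩, rfl⟩
      exact ⟨m + n, by ext z; simp [zpow_add₀ z.ne_zero]⟩)

theorem zpow_mem_laurentFunctions {k : Type*} [Field k] (n : ℤ) :
    (fun z : kˣ => (z : k) ^ n) ∈ laurentFunctions k :=
  Submodule.subset_span ⟨n, rfl⟩

/-- The functions on `k` that are polynomials. -/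
noncomputable def polynomialFunctions (k : Type*) [Field k] : Subalgebra k (k → k) :=
  (Polynomial.aeval (R := k) (fun t : k => t)).range

theorem exists_eval_of_mem_polynomialFunctions {k : Type*} [Field k] {f : k → k}
    (hf : f ∈ polynomialFunctions k) : ∃ P : Polynomial k, ∀ t, f t = P.eval t := by
  obtain ⟨P, rfl⟩ := hf
  refine ⟨P, fun t => ?_⟩
  have := Polynomial.aeval_algHom_apply (Pi.evalAlgHom k (fun _ : k => k) t) (fun t => t) P
  simp [Polynomial.aeval_def] at this ⊢


theorem comp_mem_of_mem_regularSL {k : Type*} [Field k] {m : ℕ} {X : Type*}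
    (B : Subalgebra k (X → k)) (F : X → Matrix.SpecialLinearGroup (Fin m) k)
    (hF : ∀ i j, (fun x => (F x : Matrix (Fin m) (Fin m) k) i j) ∈ B)
    {f : Matrix.SpecialLinearGroup (Fin m) k → k} (hf : f ∈ regularSL m k) :
    (fun x => f (F x)) ∈ B := by
  induction hf using Algebra.adjoin_induction with
  | mem f hf => obtain ⟨ij, rfl⟩ := hf; exact hF _ _
  | algebraMap r => exact B.algebraMap_mem r
  | add f g _ _ hf hg => exact B.add_mem hf hg
  | mul f g _ _ hf hg => exact B.mul_mem hf hg

/-! ### Generators of `SL(2, k)` and their relations -/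

/-- The torus of `SL(2, k)`. -/
def torus {k : Type*} [Field k] (z : kˣ) : Matrix.SpecialLinearGroup (Fin 2) k :=
  ⟨!![(z : k), 0; 0, (z : k)⁻¹], by simp [Matrix.det_fin_two_of]⟩

/-- The upper unitriangular matrices in `SL(2, k)`. -/
def upper {k : Type*} [Field k] (t : k) : Matrix.SpecialLinearGroup (Fin 2) k :=
  ⟨!![1, t; 0, 1], by simp [Matrix.det_fin_two_of]⟩

/-- A representative in `SL(2, k)` of the nontrivial element of the Weyl group. -/
def weyl (k : Type*) [Field k] : Matrix.SpecialLinearGroup (Fin 2) k :=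
  ⟨!![0, 1; -1, 0], by simp [Matrix.det_fin_two_of]⟩

theorem coe_torus {k : Type*} [Field k] (z : kˣ) :
    (torus z : Matrix (Fin 2) (Fin 2) k) = !![(z : k), 0; 0, (z : k)⁻¹] := rfl

theorem coe_upper {k : Type*} [Field k] (t : k) :
    (upper t : Matrix (Fin 2) (Fin 2) k) = !![1, t; 0, 1] := rfl

theorem coe_weyl {k : Type*} [Field k] :
    (weyl k : Matrix (Fin 2) (Fin 2) k) = !![0, 1; -1, 0] := rfl

theorem torus_one {k : Type*} [Field k] : torus (1 : kˣ) = 1 := by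
  apply Subtype.ext
  simp [torus, Matrix.one_fin_two]

theorem torus_mul {k : Type*} [Field k] (z w : kˣ) : torus (z * w) = torus z * torus w := by
  apply Subtype.ext
  simp [Matrix.SpecialLinearGroup.coe_mul, coe_torus, mul_comm]

theorem upper_zero {k : Type*} [Field k] : upper (0 : k) = 1 := by
  apply Subtype.ext
  simp [upper, Matrix.one_fin_two]

theorem upper_add {k : Type*} [Field k] (s t : k) : upper (s + t) = upper s * upper t := by
  apply Subtype.ext
  simp [Matrix.SpecialLinearGroup.coe_mul, coe_upper, add_comm]

theorem torus_mul_upper {k : Type*} [Field k] (z : kˣ) (t : k) :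
    torus z * upper t = upper ((z : k) ^ 2 * t) * torus z := by
  apply Subtype.ext
  have := z.ne_zero
  simp [Matrix.SpecialLinearGroup.coe_mul, coe_torus, coe_upper]
  field_simp

theorem weyl_mul_torus {k : Type*} [Field k] (z : kˣ) :
    weyl k * torus z = torus z⁻¹ * weyl k := by
  apply Subtype.ext
  simp [Matrix.SpecialLinearGroup.coe_mul, coe_torus, coe_weyl]

theorem weyl_mul_upper_mul_weyl {k : Type*} [Field k] :
    weyl k * upper (-1) * weyl k = upper 1 * weyl k * upper 1 := by
  apply Subtype.ext
  simp [Matrix.SpecialLinearGroup.coe_mul, coe_upper, coe_weyl]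

theorem iota_eq {k : Type*} [Field k] (g : GaGm k) : iota k g = upper g.t * torus g.z := by
  apply Subtype.ext
  rw [Matrix.SpecialLinearGroup.coe_mul, coe_upper, coe_torus]
  change borel g = _
  simp [borel]

/-! ### Weight decomposition under the torus -/

theorem exists_torus_eq_sum {k : Type*} [Field k] {n : ℕ} (ψ : AlgRep (regularSL 2 k) n) :
    ∃ (S : Finset ℤ) (A : ℤ → Matrix (Fin n) (Fin n) k), ∀ z : kˣ,
      (ψ.toHom (torus z) : Matrix (Fin n) (Fin n) k) = ∑ d ∈ S, (z : k) ^ d • A d := by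
  have h : ∀ i j, ∃ c : ℤ →₀ k, ∀ z : kˣ,
      (ψ.toHom (torus z) : Matrix (Fin n) (Fin n) k) i j = ∑ d ∈ c.support, (z : k) ^ d * c d := by
    intro i j
    have : (fun z : kˣ => (ψ.toHom (torus z) : Matrix (Fin n) (Fin n) k) i j) ∈
        laurentFunctions k := by
      refine comp_mem_of_mem_regularSL _ torus ?_ (ψ.regular i j)
      intro i j
      have h1 := zpow_mem_laurentFunctions (k := k) 1
      have h2 := zpow_mem_laurentFunctions (k := k) (-1)
      simp only [zpow_one, zpow_neg] at h1 h2
      have h0 := (laurentFunctions k).zero_mem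
      fin_cases i <;> fin_cases j
      · exact h1
      · exact h0
      · exact h0
      · exact h2
    obtain ⟨c, hc⟩ := Finsupp.mem_span_range_iff_exists_finsupp.1 this
    refine ⟨c, fun z => ?_⟩
    rw [← congrFun hc z, Finsupp.sum, Finset.sum_apply]
    simp [mul_comm]
  choose c hc using h
  refine ⟨Finset.univ.biUnion fun i => Finset.univ.biUnion fun j => (c i j).support,
    fun d => Matrix.of fun i j => c i j d, fun z => ?_⟩
  ext i j
  rw [hc, Matrix.sum_apply]
  simp only [Matrix.smul_apply, Matrix.of_apply, smul_eq_mul]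
  apply Finset.sum_subset
  · intro d hd
    simp only [Finset.mem_biUnion, Finset.mem_univ, true_and]
    exact ⟨i, j, hd⟩
  · intro d _ hd
    simp [Finsupp.notMem_support_iff.1 hd]

/-- The weight vectors of the torus span the representation. -/
theorem span_weight_vectors {k : Type*} [Field k] [Infinite k] {n : ℕ}
    (ψ : AlgRep (regularSL 2 k) n) :
    ⊤ ≤ Submodule.span k {u : Fin n → k | ∃ d : ℤ, ∀ z : kˣ,
      (ψ.toHom (torus z) : Matrix (Fin n) (Fin n) k) *ᵥ u = (z : k) ^ d • u} := by
  obtain ⟨S, A, hA⟩ := exists_torus_eq_sum ψ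
  -- The `A d` act as weight projections: compare coefficients of `z ^ d` in `ψ(wz) = ψ(w)ψ(z)`, the
  -- characters being linearly independent.
  have key : ∀ w : kˣ, ∀ d ∈ S,
      (ψ.toHom (torus w) : Matrix (Fin n) (Fin n) k) * A d = (w : k) ^ d • A d := by
    intro w d hd
    ext i j
    have h0 : ∑ d ∈ S, (((ψ.toHom (torus w) : Matrix (Fin n) (Fin n) k) * A d) i j -
        ((w : k) ^ d • A d) i j) • (fun z : kˣ => (z : k) ^ d) = 0 := by
      ext z
      have h1 : (ψ.toHom (torus (w * z)) : Matrix (Fin n) (Fin n) k) =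
          (ψ.toHom (torus w) : Matrix (Fin n) (Fin n) k) * ψ.toHom (torus z) := by
        rw [torus_mul, map_mul, Matrix.SpecialLinearGroup.coe_mul]
      rw [hA (w * z), hA z, Finset.mul_sum] at h1
      have h2 := congrFun (congrFun h1 i) j
      simp only [Matrix.sum_apply, Matrix.smul_apply, Matrix.mul_smul, smul_eq_mul,
        Units.val_mul, mul_zpow] at h2
      simp only [Finset.sum_apply, Pi.smul_apply, Matrix.smul_apply, smul_eq_mul, Pi.zero_apply,
        sub_mul, Finset.sum_sub_distrib]
      rw [sub_eq_zero]
      calc _ = _ := Finset.sum_congr rfl fun d _ => mul_comm _ _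
        _ = _ := h2.symm
        _ = _ := Finset.sum_congr rfl fun d _ => by ring
    exact sub_eq_zero.1 (linearIndependent_iff'.1 (linearIndependent_zpow k) S _ h0 d hd)
  intro v _
  -- At `z = 1` the expansion says that the `A d` sum to the identity.
  have hv : v = ∑ d ∈ S, A d *ᵥ v := by
    have h1 := hA 1
    rw [torus_one, map_one, Matrix.SpecialLinearGroup.coe_one] at h1
    simp only [Units.val_one, one_zpow, one_smul] at h1
    rw [← Matrix.sum_mulVec, ← h1, Matrix.one_mulVec]
  rw [hv]
  refine Submodule.sum_mem _ fun d hd => Submodule.subset_span ⟨d, fun z => ?_⟩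
  rw [Matrix.mulVec_mulVec, key z d hd, Matrix.smul_mulVec]

/-! ### Conjugation and bases of weight vectors -/

theorem units_conj_mul {M : Type*} [Monoid M] (P : Mˣ) (x y : M) :
    (P⁻¹ : Mˣ) * (x * y) * P = ((P⁻¹ : Mˣ) * x * P) * ((P⁻¹ : Mˣ) * y * P) := by
  simp only [mul_assoc, Units.mul_inv_cancel_left]

/-- The conjugation of a matrix of `SL(n, k)` by a matrix of `GL(n, k)`. -/
def conjSL {k : Type*} [Field k] {n : ℕ} (P : Matrix.GeneralLinearGroup (Fin n) k) :
    Matrix.SpecialLinearGroup (Fin n) k →* Matrix.SpecialLinearGroup (Fin n) k where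
  toFun M := ⟨((P⁻¹ : Matrix.GeneralLinearGroup (Fin n) k) : Matrix (Fin n) (Fin n) k) *
    (M : Matrix (Fin n) (Fin n) k) * (P : Matrix (Fin n) (Fin n) k), by
      rw [Matrix.det_mul, Matrix.det_mul, mul_right_comm, ← Matrix.det_mul]
      simp⟩
  map_one' := Subtype.ext (by simp)
  map_mul' M N := Subtype.ext
    (units_conj_mul P (M : Matrix (Fin n) (Fin n) k) (N : Matrix (Fin n) (Fin n) k))

theorem coe_conjSL {k : Type*} [Field k] {n : ℕ} (P : Matrix.GeneralLinearGroup (Fin n) k)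
    (M : Matrix.SpecialLinearGroup (Fin n) k) : (conjSL P M : Matrix (Fin n) (Fin n) k) =
      ((P⁻¹ : Matrix.GeneralLinearGroup (Fin n) k) : Matrix (Fin n) (Fin n) k) *
        (M : Matrix (Fin n) (Fin n) k) * (P : Matrix (Fin n) (Fin n) k) := rfl

/-- The conjugate of a representation by a matrix of `GL(n, k)`. -/
def AlgRep.conj {k : Type*} [Field k] {G : Type*} [Group G] {A : Subalgebra k (G → k)} {n : ℕ}
    (ρ : AlgRep A n) (P : Matrix.GeneralLinearGroup (Fin n) k) : AlgRep A n where
  toHom := (conjSL P).comp ρ.toHom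
  regular := fun i j => by
    simp only [MonoidHom.comp_apply, coe_conjSL, Matrix.mul_apply]
    have : (fun g => ∑ x, (∑ y, ((P⁻¹ : Matrix.GeneralLinearGroup (Fin n) k) :
        Matrix (Fin n) (Fin n) k) i y * (ρ.toHom g : Matrix (Fin n) (Fin n) k) y x) *
          (P : Matrix (Fin n) (Fin n) k) x j) =
        ∑ x, (P : Matrix (Fin n) (Fin n) k) x j •
          ∑ y, ((P⁻¹ : Matrix.GeneralLinearGroup (Fin n) k) : Matrix (Fin n) (Fin n) k) i y •
            (fun g => (ρ.toHom g : Matrix (Fin n) (Fin n) k) y x) := by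
      ext g
      simp [Finset.sum_apply, mul_comm]
    rw [this]
    exact A.sum_mem fun x _ => A.smul_mem (A.sum_mem fun y _ => A.smul_mem (ρ.regular y x) _) _

theorem AlgRep.coe_conj {k : Type*} [Field k] {G : Type*} [Group G] {A : Subalgebra k (G → k)}
    {n : ℕ} (ρ : AlgRep A n) (P : Matrix.GeneralLinearGroup (Fin n) k) (g : G) :
    ((ρ.conj P).toHom g : Matrix (Fin n) (Fin n) k) =
      ((P⁻¹ : Matrix.GeneralLinearGroup (Fin n) k) : Matrix (Fin n) (Fin n) k) *
        (ρ.toHom g : Matrix (Fin n) (Fin n) k) * (P : Matrix (Fin n) (Fin n) k) := rfl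

theorem AlgRep.conj_conj {k : Type*} [Field k] {G : Type*} [Group G] {A : Subalgebra k (G → k)}
    {n : ℕ} (ρ : AlgRep A n) (P Q : Matrix.GeneralLinearGroup (Fin n) k) :
    (ρ.conj P).conj Q = ρ.conj (P * Q) := by
  apply AlgRep.ext
  ext1 g
  apply Subtype.ext
  simp only [AlgRep.coe_conj, mul_inv_rev, Units.val_mul, Matrix.mul_assoc]

theorem AlgRep.equivalent_conj {k : Type*} [Field k] {G : Type*} [Group G]
    {A : Subalgebra k (G → k)} {n : ℕ} (ρ : AlgRep A n)
    (P : Matrix.GeneralLinearGroup (Fin n) k) : ρ.Equivalent (ρ.conj P) :=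
  ⟨P, fun _ => rfl⟩

theorem IsFundamental.conj {k : Type*} [Field k] {n : ℕ} {φ : AlgRep (regularGaGm k) n}
    {ψ : AlgRep (regularSL 2 k) n} (h : φ.toHom = ψ.toHom.comp (iota k))
    (P : Matrix.GeneralLinearGroup (Fin n) k) :
    (φ.conj P).toHom = (ψ.conj P).toHom.comp (iota k) := by
  ext1 g
  apply Subtype.ext
  rw [AlgRep.coe_conj, h]
  rfl

theorem exists_weight_basis {k : Type*} [Field k] [Infinite k] {n : ℕ}
    (ψ : AlgRep (regularSL 2 k) n) :
    ∃ (b : Module.Basis (Fin n) k (Fin n → k)) (w : Fin n → ℤ), ∀ i, ∀ z : kˣ,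
      (ψ.toHom (torus z) : Matrix (Fin n) (Fin n) k) *ᵥ b i = (z : k) ^ w i • b i := by
  let B := Module.Basis.ofSpan (span_weight_vectors ψ)
  have hB := Module.Basis.ofSpan_subset (span_weight_vectors ψ)
  let b := B.reindex (B.indexEquiv (Pi.basisFun k (Fin n)))
  have h : ∀ i, ∃ d : ℤ, ∀ z : kˣ,
      (ψ.toHom (torus z) : Matrix (Fin n) (Fin n) k) *ᵥ b i = (z : k) ^ d • b i := by
    intro i
    apply hB
    rw [Module.Basis.reindex_apply]
    exact ⟨_, rfl⟩
  choose w hw using h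
  exact ⟨b, w, hw⟩

/-- The matrix of `GL(n, k)` whose columns are the vectors of a basis. -/
noncomputable def basisGL {k : Type*} [Field k] {n : ℕ} (b : Module.Basis (Fin n) k (Fin n → k)) :
    Matrix.GeneralLinearGroup (Fin n) k where
  val := (Pi.basisFun k (Fin n)).toMatrix b
  inv := b.toMatrix (Pi.basisFun k (Fin n))
  val_inv := Module.Basis.toMatrix_mul_toMatrix_flip _ _
  inv_val := Module.Basis.toMatrix_mul_toMatrix_flip _ _

theorem conj_basisGL_torus {k : Type*} [Field k] {n : ℕ} (ψ : AlgRep (regularSL 2 k) n)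
    (b : Module.Basis (Fin n) k (Fin n → k)) (w : Fin n → ℤ) (hw : ∀ i, ∀ z : kˣ,
      (ψ.toHom (torus z) : Matrix (Fin n) (Fin n) k) *ᵥ b i = (z : k) ^ w i • b i) (z : kˣ) :
    ((ψ.conj (basisGL b)).toHom (torus z) : Matrix (Fin n) (Fin n) k) =
      Matrix.diagonal fun i => (z : k) ^ w i := by
  have h : (ψ.toHom (torus z) : Matrix (Fin n) (Fin n) k) * (basisGL b).val =
      (basisGL b).val * Matrix.diagonal fun i => (z : k) ^ w i := by
    ext i j
    rw [Matrix.mul_diagonal]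
    have := congrFun (hw j z) i
    simpa [Matrix.mulVec, dotProduct, Matrix.mul_apply, basisGL, Module.Basis.toMatrix_apply,
      mul_comm] using this
  rw [AlgRep.coe_conj, Matrix.mul_assoc, h, ← Matrix.mul_assoc, Units.inv_mul, Matrix.one_mul]

/-! ### Weyl symmetry of the weights -/

/-- The Weyl element permutes weight spaces by negating the weight. -/
theorem weyl_apply_eq_zero {k : Type*} [Field k] [Infinite k] {n : ℕ}
    (ψ : AlgRep (regularSL 2 k) n) (w : Fin n → ℤ)
    (hw : ∀ z : kˣ, (ψ.toHom (torus z) : Matrix (Fin n) (Fin n) k) =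
      Matrix.diagonal fun i => (z : k) ^ w i) (i j : Fin n) (hij : w j ≠ - w i) :
    (ψ.toHom (weyl k) : Matrix (Fin n) (Fin n) k) i j = 0 := by
  by_contra h0
  apply hij
  apply eq_of_zpow_eq (k := k)
  intro z
  have := congrArg (fun x => (ψ.toHom x : Matrix (Fin n) (Fin n) k) i j) (weyl_mul_torus z)
  simp only [map_mul, Matrix.SpecialLinearGroup.coe_mul, hw, Matrix.mul_diagonal,
    Matrix.diagonal_mul] at this
  rw [mul_comm] at this
  simpa using mul_right_cancel₀ h0 this

/-- The torus acts with determinant `1`, and this determinant is `z` to the sum of the weights. -/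
theorem weight_sum_eq_zero {k : Type*} [Field k] [Infinite k] {n : ℕ}
    (ψ : AlgRep (regularSL 2 k) n) (w : Fin n → ℤ)
    (hw : ∀ z : kˣ, (ψ.toHom (torus z) : Matrix (Fin n) (Fin n) k) =
      Matrix.diagonal fun i => (z : k) ^ w i) : ∑ i, w i = 0 := by
  apply eq_of_zpow_eq (k := k)
  intro z
  have h := (ψ.toHom (torus z)).det_coe
  rw [hw, Matrix.det_diagonal] at h
  rw [zpow_zero, ← h]
  have : ∀ s : Finset (Fin n), (z : k) ^ (∑ i ∈ s, w i) = ∏ i ∈ s, (z : k) ^ w i := by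
    intro s
    induction s using Finset.induction_on with
    | empty => simp
    | insert a s ha ih => rw [Finset.sum_insert ha, Finset.prod_insert ha, zpow_add₀ z.ne_zero, ih]
  exact this _

/-- Otherwise row `i` of the image of the Weyl element would vanish, contradicting determinant `1`.
-/
theorem exists_weight_eq_neg {k : Type*} [Field k] [Infinite k] {n : ℕ}
    (ψ : AlgRep (regularSL 2 k) n) (w : Fin n → ℤ)
    (hw : ∀ z : kˣ, (ψ.toHom (torus z) : Matrix (Fin n) (Fin n) k) =
      Matrix.diagonal fun i => (z : k) ^ w i) (i : Fin n) : ∃ j, w j = - w i := by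
  by_contra! h
  have := (ψ.toHom (weyl k)).det_coe
  rw [Matrix.det_eq_zero_of_row_eq_zero i fun j => weyl_apply_eq_zero ψ w hw i j (h j)] at this
  exact zero_ne_one this

/-- The weights of the torus, on a three-dimensional representation of `SL(2, k)`. -/
def weights (m : ℕ) : Fin 3 → ℤ := ![(m : ℤ), 0, -(m : ℤ)]

/-- The negation hypothesis ignores multiplicities and by itself admits `(m, m, -m)`; the zero sum
excludes this. -/
theorem exists_perm_weights (w : Fin 3 → ℤ) (hsum : ∑ i, w i = 0)
    (hneg : ∀ i, ∃ j, w j = - w i) :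
    ∃ (σ : Equiv.Perm (Fin 3)) (m : ℕ), ∀ i, w (σ i) = weights m i := by
  have h0 := hneg 0
  have h1 := hneg 1
  have h2 := hneg 2
  simp only [Fin.exists_fin_succ, Fin.sum_univ_three, Fin.forall_fin_succ, weights] at *
  simp at *
  have key : (0 ≤ w 0 ∧ w 1 = 0 ∧ w 2 = - w 0) ∨ (0 ≤ w 2 ∧ w 1 = 0 ∧ w 0 = - w 2) ∨
    (0 ≤ w 1 ∧ w 0 = 0 ∧ w 2 = - w 1) ∨ (0 ≤ w 0 ∧ w 2 = 0 ∧ w 1 = - w 0) ∨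
    (0 ≤ w 1 ∧ w 2 = 0 ∧ w 0 = - w 1) ∨ (0 ≤ w 2 ∧ w 0 = 0 ∧ w 1 = - w 2) := by omega
  rcases key with h | h | h | h | h | h
  · refine ⟨1, (w 0).natAbs, ?_⟩
    simp [abs_of_nonneg h.1]; omega
  · refine ⟨Equiv.swap 0 2, (w 2).natAbs, ?_⟩
    rw [show (Equiv.swap 0 2 : Equiv.Perm (Fin 3)) 1 = 1 by decide]
    simp [abs_of_nonneg h.1]; omega
  · refine ⟨Equiv.swap 0 1, (w 1).natAbs, ?_⟩
    rw [show (Equiv.swap 0 1 : Equiv.Perm (Fin 3)) 2 = 2 by decide]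
    simp [abs_of_nonneg h.1]; omega
  · refine ⟨Equiv.swap 1 2, (w 0).natAbs, ?_⟩
    rw [show (Equiv.swap 1 2 : Equiv.Perm (Fin 3)) 0 = 0 by decide]
    simp [abs_of_nonneg h.1]; omega
  · refine ⟨Equiv.swap 0 1 * Equiv.swap 1 2, (w 1).natAbs, ?_⟩
    rw [show (Equiv.swap 0 1 * Equiv.swap 1 2 : Equiv.Perm (Fin 3)) 0 = 1 by decide,
      show (Equiv.swap 0 1 * Equiv.swap 1 2 : Equiv.Perm (Fin 3)) 1 = 2 by decide,
      show (Equiv.swap 0 1 * Equiv.swap 1 2 : Equiv.Perm (Fin 3)) 2 = 0 by decide]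
    omega
  · refine ⟨Equiv.swap 1 2 * Equiv.swap 0 1, (w 2).natAbs, ?_⟩
    rw [show (Equiv.swap 1 2 * Equiv.swap 0 1 : Equiv.Perm (Fin 3)) 0 = 2 by decide,
      show (Equiv.swap 1 2 * Equiv.swap 0 1 : Equiv.Perm (Fin 3)) 1 = 0 by decide,
      show (Equiv.swap 1 2 * Equiv.swap 0 1 : Equiv.Perm (Fin 3)) 2 = 1 by decide]
    omega

theorem exists_conj_torus_eq_diagonal {k : Type*} [Field k] [Infinite k]
    (ψ : AlgRep (regularSL 2 k) 3) :
    ∃ (P : Matrix.GeneralLinearGroup (Fin 3) k) (m : ℕ), ∀ z : kˣ,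
      ((ψ.conj P).toHom (torus z) : Matrix (Fin 3) (Fin 3) k) =
        Matrix.diagonal fun i => (z : k) ^ weights m i := by
  obtain ⟨b, w, hw⟩ := exists_weight_basis ψ
  have h := conj_basisGL_torus ψ b w hw
  obtain ⟨σ, m, hσ⟩ := exists_perm_weights w (weight_sum_eq_zero _ w h)
    (exists_weight_eq_neg _ w h)
  refine ⟨basisGL (b.reindex σ.symm), m, conj_basisGL_torus ψ _ _ fun i z => ?_⟩
  rw [← hσ, Module.Basis.reindex_apply, Equiv.symm_symm]
  exact hw _ z

/-! ### The image of the unipotent subgroup -/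

/-- The entries of the unipotent matrices are monomials. -/
theorem upper_apply {k : Type*} [Field k] [Infinite k] {n : ℕ}
    (ψ : AlgRep (regularSL 2 k) n) (w : Fin n → ℤ)
    (hw : ∀ z : kˣ, (ψ.toHom (torus z) : Matrix (Fin n) (Fin n) k) =
      Matrix.diagonal fun i => (z : k) ^ w i) (i j : Fin n) :
    (∃ d : ℕ, (2 * d : ℤ) = w i - w j ∧ ∃ c, c ≠ 0 ∧ ∀ t,
      (ψ.toHom (upper t) : Matrix (Fin n) (Fin n) k) i j = c * t ^ d) ∨
    ∀ t, (ψ.toHom (upper t) : Matrix (Fin n) (Fin n) k) i j = 0 := by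
  have : (fun t : k => (ψ.toHom (upper t) : Matrix (Fin n) (Fin n) k) i j) ∈
      polynomialFunctions k := by
    refine comp_mem_of_mem_regularSL _ upper ?_ (ψ.regular i j)
    intro i j
    have h0 := (polynomialFunctions k).zero_mem
    have h1 := (polynomialFunctions k).one_mem
    fin_cases i <;> fin_cases j
    · exact h1
    · exact ⟨Polynomial.X, by simp; rfl⟩
    · exact h0
    · exact h1
  obtain ⟨P, hP⟩ := exists_eval_of_mem_polynomialFunctions this
  simp only [hP]
  apply eval_eq_of_homogeneous
  intro z t
  have := congrArg (fun x => (ψ.toHom x : Matrix (Fin n) (Fin n) k) i j) (torus_mul_upper z t)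
  simp only [map_mul, Matrix.SpecialLinearGroup.coe_mul, hw, Matrix.mul_diagonal,
    Matrix.diagonal_mul, hP] at this
  have hz := zpow_ne_zero (w j) z.ne_zero
  rw [zpow_sub₀ z.ne_zero, div_mul_eq_mul_div, this, mul_div_cancel_right₀ _ hz]

/-- Between equal weights the monomial has degree `0`, so the entry is constant and equals its value
at `t = 0`. -/
theorem upper_diag {k : Type*} [Field k] [Infinite k] {n : ℕ}
    (ψ : AlgRep (regularSL 2 k) n) (w : Fin n → ℤ)
    (hw : ∀ z : kˣ, (ψ.toHom (torus z) : Matrix (Fin n) (Fin n) k) =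
      Matrix.diagonal fun i => (z : k) ^ w i) (i j : Fin n) (hij : w i = w j) (t : k) :
    (ψ.toHom (upper t) : Matrix (Fin n) (Fin n) k) i j = (1 : Matrix (Fin n) (Fin n) k) i j := by
  have h0 : (ψ.toHom (upper (0 : k)) : Matrix (Fin n) (Fin n) k) i j =
      (1 : Matrix (Fin n) (Fin n) k) i j := by
    rw [upper_zero, map_one, Matrix.SpecialLinearGroup.coe_one]
  rw [← h0]
  rcases upper_apply ψ w hw i j with ⟨d, hd, c, -, h⟩ | h
  · have : d = 0 := by omega
    subst this
    simp [h]
  · simp [h]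

/-- A nonzero entry would be a monomial of negative degree `(w i - w j) / 2`. -/
theorem upper_lower_apply {k : Type*} [Field k] [Infinite k] {n : ℕ}
    (ψ : AlgRep (regularSL 2 k) n) (w : Fin n → ℤ)
    (hw : ∀ z : kˣ, (ψ.toHom (torus z) : Matrix (Fin n) (Fin n) k) =
      Matrix.diagonal fun i => (z : k) ^ w i) (i j : Fin n) (hij : w i < w j) (t : k) :
    (ψ.toHom (upper t) : Matrix (Fin n) (Fin n) k) i j = 0 := by
  rcases upper_apply ψ w hw i j with ⟨d, hd, c, -, h⟩ | h
  · omega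
  · exact h t

theorem exists_upper_eq {k : Type*} [Field k] [Infinite k]
    (ψ : AlgRep (regularSL 2 k) 3) {m : ℕ} (hm : m ≠ 0)
    (hw : ∀ z : kˣ, (ψ.toHom (torus z) : Matrix (Fin 3) (Fin 3) k) =
      Matrix.diagonal fun i => (z : k) ^ weights m i) :
    ∃ (n : ℕ) (α β γ : k), (∀ t, (ψ.toHom (upper t) : Matrix (Fin 3) (Fin 3) k) =
      !![1, α * t ^ n, β * t ^ m; 0, 1, γ * t ^ n; 0, 0, 1]) ∧
      (α ≠ 0 → m = 2 * n) ∧ (γ ≠ 0 → m = 2 * n) := by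
  have h01 : ∃ α : k, (∀ t, (ψ.toHom (upper t) : Matrix (Fin 3) (Fin 3) k) 0 1 =
      α * t ^ (m / 2)) ∧ (α ≠ 0 → m = 2 * (m / 2)) := by
    rcases upper_apply ψ _ hw 0 1 with ⟨d, hd, c, -, h⟩ | h
    · have hd' : (2 * d : ℤ) = m := by simpa [weights] using hd
      obtain rfl : d = m / 2 := by omega
      exact ⟨c, h, fun _ => by omega⟩
    · exact ⟨0, by simpa using h, by simp⟩
  have h12 : ∃ γ : k, (∀ t, (ψ.toHom (upper t) : Matrix (Fin 3) (Fin 3) k) 1 2 =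
      γ * t ^ (m / 2)) ∧ (γ ≠ 0 → m = 2 * (m / 2)) := by
    rcases upper_apply ψ _ hw 1 2 with ⟨d, hd, c, -, h⟩ | h
    · have hd' : (2 * d : ℤ) = m := by simpa [weights] using hd
      obtain rfl : d = m / 2 := by omega
      exact ⟨c, h, fun _ => by omega⟩
    · exact ⟨0, by simpa using h, by simp⟩
  have h02 : ∃ β : k, ∀ t, (ψ.toHom (upper t) : Matrix (Fin 3) (Fin 3) k) 0 2 = β * t ^ m := by
    rcases upper_apply ψ _ hw 0 2 with ⟨d, hd, c, -, h⟩ | h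
    · have hd' : (2 * d : ℤ) = m + m := by simpa [weights] using hd
      obtain rfl : d = m := by omega
      exact ⟨c, h⟩
    · exact ⟨0, by simpa using h⟩
  obtain ⟨α, hα, hα'⟩ := h01
  obtain ⟨γ, hγ, hγ'⟩ := h12
  obtain ⟨β, hβ⟩ := h02
  refine ⟨m / 2, α, β, γ, fun t => ?_, hα', hγ'⟩
  have hmpos : (0 : ℤ) < m := by omega
  have d0 := upper_diag ψ _ hw 0 0 rfl t
  have d1 := upper_diag ψ _ hw 1 1 rfl t
  have d2 := upper_diag ψ _ hw 2 2 rfl t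
  have l0 := upper_lower_apply ψ _ hw 1 0 (by simpa [weights] using hmpos) t
  have l1 := upper_lower_apply ψ _ hw 2 1 (by simpa [weights] using hmpos) t
  have l2 := upper_lower_apply ψ _ hw 2 0 (by simp [weights]; omega) t
  rw [Matrix.one_apply_eq] at d0 d1 d2
  ext i j
  fin_cases i <;> fin_cases j
  · exact d0
  · exact hα t
  · exact hβ t
  · exact l0
  · exact d1
  · exact hγ t
  · exact l2
  · exact l1
  · exact d2

/-- The unipotent radical cannot act too degenerately on a representation of `SL(2, k)`. -/
theorem mul_ne_zero_or_ne_zero {k : Type*} [Field k] [Infinite k]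
    (ψ : AlgRep (regularSL 2 k) 3) {m : ℕ} (hm : m ≠ 0)
    (hw : ∀ z : kˣ, (ψ.toHom (torus z) : Matrix (Fin 3) (Fin 3) k) =
      Matrix.diagonal fun i => (z : k) ^ weights m i) {n : ℕ} {α β γ : k}
    (hU : ∀ t, (ψ.toHom (upper t) : Matrix (Fin 3) (Fin 3) k) =
      !![1, α * t ^ n, β * t ^ m; 0, 1, γ * t ^ n; 0, 0, 1]) : β ≠ 0 ∨ α * γ ≠ 0 := by
  by_contra! h
  obtain ⟨rfl, hαγ⟩ := h
  have hW := weyl_apply_eq_zero ψ _ hw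
  have hmpos : (0 : ℤ) < m := by omega
  have w00 := hW 0 0 (by simp [weights]; omega)
  have w01 := hW 0 1 (by simp [weights]; omega)
  have w10 := hW 1 0 (by simp [weights]; omega)
  have w12 := hW 1 2 (by simp [weights]; omega)
  have w21 := hW 2 1 (by simp [weights]; omega)
  have w22 := hW 2 2 (by simp [weights]; omega)
  -- Let `W` be the image of the Weyl element, which is antidiagonal. The `(0, 2)` entry of the
  -- relation reads `0 = W₀₂ + αγ W₁₁ + β² W₂₀`, so here `W₀₂ = 0` and `W` would be singular.
  have h1 := congrArg (fun x => (ψ.toHom x : Matrix (Fin 3) (Fin 3) k) 0 2)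
    (weyl_mul_upper_mul_weyl (k := k))
  simp only [map_mul, Matrix.SpecialLinearGroup.coe_mul, hU, Matrix.mul_apply,
    Fin.sum_univ_three, w00, w01, w10, w12, w21, w22] at h1
  simp at h1
  have hdet := (ψ.toHom (weyl k)).det_coe
  rw [Matrix.det_fin_three] at hdet
  simp only [w00, w01, w10, w12, w21, w22] at hdet
  have w02 : (ψ.toHom (weyl k) : Matrix (Fin 3) (Fin 3) k) 0 2 = 0 := by
    linear_combination -h1 - (ψ.toHom (weyl k) : Matrix (Fin 3) (Fin 3) k) 1 1 * hαγ
  simp [w02] at hdet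

theorem upper_relations {k : Type*} [Field k]
    (ψ : AlgRep (regularSL 2 k) 3) {m n : ℕ} {α β γ : k}
    (hU : ∀ t, (ψ.toHom (upper t) : Matrix (Fin 3) (Fin 3) k) =
      !![1, α * t ^ n, β * t ^ m; 0, 1, γ * t ^ n; 0, 0, 1]) (s t : k) :
    α * (s + t) ^ n = α * (s ^ n + t ^ n) ∧ γ * (s + t) ^ n = γ * (s ^ n + t ^ n) ∧
      β * (s + t) ^ m = β * (s ^ m + t ^ m) + α * γ * (s ^ n * t ^ n) := by
  have h : ∀ i j, _ := fun i j =>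
    congrArg (fun x => (ψ.toHom x : Matrix (Fin 3) (Fin 3) k) i j) (upper_add s t)
  simp only [map_mul, Matrix.SpecialLinearGroup.coe_mul, hU, Matrix.mul_apply,
    Fin.sum_univ_three] at h
  have h01 := h 0 1
  have h12 := h 1 2
  have h02 := h 0 2
  simp at h01 h12 h02
  refine ⟨by linear_combination h01, by linear_combination h12, by linear_combination h02⟩

/-! ### Triangular shapes and their coefficients -/

/-- The diagonal matrix of `GL(3, k)` with the given entries. -/
def diagonalGL {k : Type*} [Field k] (c : Fin 3 → kˣ) : Matrix.GeneralLinearGroup (Fin 3) k where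
  val := Matrix.diagonal fun i => (c i : k)
  inv := Matrix.diagonal fun i => ((c i)⁻¹ : k)
  val_inv := by simp
  inv_val := by simp

theorem conj_diagonalGL_apply {k : Type*} [Field k] {G : Type*} [Group G]
    {A : Subalgebra k (G → k)} (ρ : AlgRep A 3) (c : Fin 3 → kˣ) (g : G) (i j : Fin 3) :
    ((ρ.conj (diagonalGL c)).toHom g : Matrix (Fin 3) (Fin 3) k) i j =
      (c i : k)⁻¹ * (ρ.toHom g : Matrix (Fin 3) (Fin 3) k) i j * c j := by
  rw [AlgRep.coe_conj]
  change (Matrix.diagonal (fun i => ((c i : k)⁻¹)) * (ρ.toHom g : Matrix (Fin 3) (Fin 3) k) *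
    Matrix.diagonal (fun i => (c i : k))) i j = _
  rw [Matrix.mul_diagonal, Matrix.diagonal_mul]

/-- Exponents and coefficients of a representation of `𝔾ₐ ⋊ 𝔾ₘ` in triangular form. -/
structure ShapeData (k : Type*) where
  m : ℕ
  n : ℕ
  α : k
  β : k
  γ : k

/-- The representation `φ` is triangular, with the exponents and coefficients `D`. -/
def HasShape {k : Type*} [Field k] (φ : AlgRep (regularGaGm k) 3) (D : ShapeData k) : Prop :=
  ∀ g : GaGm k, (φ.toHom g : Matrix (Fin 3) (Fin 3) k) =
    !![(g.z : k) ^ D.m, D.α * g.t ^ D.n, D.β * g.t ^ D.m * (g.z : k)⁻¹ ^ D.m;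
       0, 1, D.γ * g.t ^ D.n * (g.z : k)⁻¹ ^ D.m;
       0, 0, (g.z : k)⁻¹ ^ D.m]

/-- The characteristics in which a form occurs. -/
def SharpForm.Allowed (p : ℕ) : SharpForm → Prop
  | .I => 3 ≤ p
  | .IV => True
  | .V => p = 2
  | .VII => p = 2
  | .XII => True

/-- The exponents and coefficients of a form. -/
def SharpForm.data (k : Type*) [Field k] (p e : ℕ) : SharpForm → ShapeData k
  | .I => ⟨2 * p ^ e, p ^ e, 1, 1 / 2, 1⟩
  | .IV => ⟨p ^ e, 0, 0, 1, 0⟩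
  | .V => ⟨2 * p ^ e, p ^ e, 1, 1, 0⟩
  | .VII => ⟨2 * p ^ e, p ^ e, 0, 1, 1⟩
  | .XII => ⟨0, 0, 0, 0, 0⟩

/-- With `a = z`, `b = t z⁻¹`, `d = z⁻¹`, all five forms become one family of triangular matrices,
so that they can be compared by exponents and coefficients. -/
theorem hasSharpForm_iff {k : Type*} [Field k] (p : ℕ) (φ : AlgRep (regularGaGm k) 3)
    (lam : SharpForm) :
    HasSharpForm p φ lam ↔ lam.Allowed p ∧ ∃ e, HasShape φ (lam.data k p e) := by
  have hz : ∀ (g : GaGm k) (q : ℕ),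
      (g.z : k) ^ q * (g.t ^ q * (g.z : k)⁻¹ ^ q) = g.t ^ q := by
    intro g q
    rw [← mul_pow, ← mul_pow, mul_comm g.t, mul_inv_cancel_left₀ g.z.ne_zero]
  have hz' : ∀ (g : GaGm k) (q : ℕ), g.t ^ q * ((g.z : k)⁻¹ ^ q * (g.z : k)⁻¹ ^ q) =
      g.t ^ q * (g.z : k)⁻¹ ^ (2 * q) := by
    intro g q
    ring
  have hb : ∀ g : GaGm k, borel g 0 0 = g.z ∧ borel g 0 1 = g.t * (g.z : k)⁻¹ ∧
      borel g 1 1 = (g.z : k)⁻¹ := fun g => ⟨rfl, rfl, rfl⟩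
  cases lam
  · simp only [HasSharpForm, SharpForm.Allowed, HasShape, SharpForm.data, hb, hz, hz', mul_pow,
      one_mul, mul_assoc]
  · simp only [HasSharpForm, SharpForm.Allowed, HasShape, SharpForm.data, hb, mul_pow,
      one_mul, zero_mul, true_and]
  · simp only [HasSharpForm, SharpForm.Allowed, HasShape, SharpForm.data, hb, hz, mul_pow,
      one_mul, zero_mul]
  · simp only [HasSharpForm, SharpForm.Allowed, HasShape, SharpForm.data, hb, hz', mul_pow,
      one_mul, zero_mul, mul_assoc]
  · simp only [HasSharpForm, SharpForm.Allowed, HasShape, SharpForm.data, pow_zero, zero_mul,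
      true_and, exists_const]

theorem HasShape.of_torus_upper {k : Type*} [Field k] {φ : AlgRep (regularGaGm k) 3}
    {ψ : AlgRep (regularSL 2 k) 3} (hφ : φ.toHom = ψ.toHom.comp (iota k)) {D : ShapeData k}
    (hw : ∀ z : kˣ, (ψ.toHom (torus z) : Matrix (Fin 3) (Fin 3) k) =
      Matrix.diagonal fun i => (z : k) ^ weights D.m i)
    (hU : ∀ t, (ψ.toHom (upper t) : Matrix (Fin 3) (Fin 3) k) =
      !![1, D.α * t ^ D.n, D.β * t ^ D.m; 0, 1, D.γ * t ^ D.n; 0, 0, 1]) : HasShape φ D := by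
  intro g
  rw [hφ, MonoidHom.comp_apply, iota_eq, map_mul, Matrix.SpecialLinearGroup.coe_mul, hw, hU]
  ext i j
  rw [Matrix.mul_diagonal]
  fin_cases i <;> fin_cases j <;> simp [weights]

theorem HasShape.conj {k : Type*} [Field k] {φ : AlgRep (regularGaGm k) 3} {D : ShapeData k}
    (h : HasShape φ D) (c : Fin 3 → kˣ) : HasShape (φ.conj (diagonalGL c))
      ⟨D.m, D.n, (c 0 : k)⁻¹ * D.α * c 1, (c 0 : k)⁻¹ * D.β * c 2, (c 1 : k)⁻¹ * D.γ * c 2⟩ := by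
  intro g
  ext i j
  rw [conj_diagonalGL_apply, h g]
  fin_cases i <;> fin_cases j <;> simp [mul_right_comm] <;> ring

theorem HasShape.eq {k : Type*} [Field k] {φ φ' : AlgRep (regularGaGm k) 3} {D : ShapeData k}
    (h : HasShape φ D) (h' : HasShape φ' D) : φ = φ' := by
  apply AlgRep.ext
  ext1 g
  apply Subtype.ext
  exact (h g).trans (h' g).symm

/-! ### Invariants of the equivalence class -/

theorem HasShape.m_eq {k : Type*} [Field k] [Infinite k] {φ φ' : AlgRep (regularGaGm k) 3}
    {D D' : ShapeData k} (h : HasShape φ D) (h' : HasShape φ' D') (hφ : φ.Equivalent φ') :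
    D.m = D'.m := by
  apply eq_of_add_inv_pow_eq (k := k)
  intro z
  obtain ⟨P, hP⟩ := hφ
  -- The `1` lies in `Multiplicative k`, so this is the torus element with `t = 0`, of trace `z^m +
  -- 1 + z^(-m)`.
  have h1 := congrArg Matrix.trace (hP ⟨1, z⟩)
  rw [Matrix.trace_mul_cycle, Units.mul_inv, Matrix.one_mul, h, h', Matrix.trace_fin_three,
    Matrix.trace_fin_three] at h1
  simp [GaGm.z] at h1 ⊢
  linear_combination h1

theorem HasShape.torus {k : Type*} [Field k] {φ : AlgRep (regularGaGm k) 3}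
    {D : ShapeData k} (h : HasShape φ D) (hm : D.m ≠ 0) (z : kˣ) :
    (φ.toHom ⟨1, z⟩ : Matrix (Fin 3) (Fin 3) k) =
      Matrix.diagonal fun i => (z : k) ^ weights D.m i := by
  -- The exponent `n` may be `0`, and then `0 ^ n = 1`; the value at the identity shows that the
  -- off-diagonal entries still vanish at `t = 0`.
  have h1 := h 1
  rw [map_one, Matrix.SpecialLinearGroup.coe_one] at h1
  have h01 := congrFun (congrFun h1 0) 1
  have h12 := congrFun (congrFun h1 1) 2
  simp [GaGm.t_one, GaGm.z_one] at h01 h12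
  rw [h]
  ext i j
  fin_cases i <;> fin_cases j <;> simp [GaGm.t, GaGm.z, weights, hm]
  · tauto
  · tauto

theorem HasShape.coeff_eq_zero_iff {k : Type*} [Field k] [Infinite k]
    {φ φ' : AlgRep (regularGaGm k) 3}
    {D D' : ShapeData k} (h : HasShape φ D) (h' : HasShape φ' D') (hφ : φ.Equivalent φ')
    (hm : D.m ≠ 0) : (D.α = 0 ↔ D'.α = 0) ∧ (D.γ = 0 ↔ D'.γ = 0) := by
  have hmm := h.m_eq h' hφ
  obtain ⟨P, hP⟩ := hφ
  have hP' : ∀ g, (φ.toHom g : Matrix (Fin 3) (Fin 3) k) * P.val =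
      P.val * (φ'.toHom g : Matrix (Fin 3) (Fin 3) k) := by
    intro g
    rw [← hP, Matrix.mul_assoc, ← Matrix.mul_assoc P.val, Units.mul_inv, Matrix.one_mul]
  have ht := h.torus hm
  have ht' := h'.torus (hmm ▸ hm)
  rw [← hmm] at ht'
  -- The intertwiner commutes with the torus, whose weights `m, 0, -m` are distinct.
  have hoff : ∀ i j, i ≠ j → P.val i j = 0 := by
    intro i j hij
    by_contra h0
    have : weights D.m i = weights D.m j := by
      apply eq_of_zpow_eq (k := k)
      intro z
      have := congrFun (congrFun (hP' ⟨1, z⟩) i) j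
      rw [ht, ht', Matrix.mul_diagonal, Matrix.diagonal_mul, mul_comm] at this
      exact mul_left_cancel₀ h0 this
    fin_cases i <;> fin_cases j <;> simp [weights] at this hij <;> omega
  have hdet : P.val.det ≠ 0 := ((Matrix.isUnit_iff_isUnit_det _).1 P.isUnit).ne_zero
  rw [Matrix.det_fin_three] at hdet
  simp only [hoff 0 1 (by decide), hoff 0 2 (by decide), hoff 1 0 (by decide),
    hoff 1 2 (by decide), hoff 2 0 (by decide), hoff 2 1 (by decide)] at hdet
  simp at hdet
  obtain ⟨⟨h0, h1⟩, h2⟩ := hdet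
  -- At `t = z = 1` the monomials reduce to their coefficients, so the exponents `n` need not be
  -- compared.
  have hU : ∀ i j, _ := fun i j => congrFun (congrFun (hP' ⟨Multiplicative.ofAdd 1, 1⟩) i) j
  simp only [h _, h' _, Matrix.mul_apply, Fin.sum_univ_three] at hU
  have h01 := hU 0 1
  have h12 := hU 1 2
  simp [GaGm.t, GaGm.z, hoff 0 1 (by decide), hoff 0 2 (by decide), hoff 1 0 (by decide),
    hoff 1 2 (by decide), hoff 2 1 (by decide)] at h01 h12
  constructor
  · rw [← mul_eq_zero_iff_right h1, h01, mul_eq_zero_iff_left h0]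
  · rw [← mul_eq_zero_iff_right h2, h12, mul_eq_zero_iff_left h1]

/-! ### Classification of the coefficients -/

theorem HasShape.exists_sharp {k : Type*} [Field k] [IsAlgClosed k] (p : ℕ) [Fact p.Prime]
    [CharP k p] {φ : AlgRep (regularGaGm k) 3} {m n : ℕ} {α β γ : k}
    (h : HasShape φ ⟨m, n, α, β, γ⟩) (hm : m ≠ 0) (hα : α ≠ 0 → m = 2 * n)
    (hγ : γ ≠ 0 → m = 2 * n) (hne : β ≠ 0 ∨ α * γ ≠ 0)
    (hrel : ∀ s t : k, α * (s + t) ^ n = α * (s ^ n + t ^ n) ∧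
      γ * (s + t) ^ n = γ * (s ^ n + t ^ n) ∧
      β * (s + t) ^ m = β * (s ^ m + t ^ m) + α * γ * (s ^ n * t ^ n)) :
    ∃ (c : Fin 3 → kˣ) (lam : SharpForm) (e : ℕ), lam.Allowed p ∧
      HasShape (φ.conj (diagonalGL c)) (lam.data k p e) := by
  have hpow : (α ≠ 0 ∨ γ ≠ 0) → ∃ e, n = p ^ e ∧ m = 2 * p ^ e := by
    intro hαγ
    have hmn : m = 2 * n := hαγ.elim hα hγ
    obtain ⟨e, he⟩ := exists_eq_pow_of_add_pow (k := k) p (n := n) (by omega) fun s t => by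
      rcases hαγ with h0 | h0
      · exact mul_left_cancel₀ h0 (hrel s t).1
      · exact mul_left_cancel₀ h0 (hrel s t).2.1
    exact ⟨e, he, by rw [hmn, he]⟩
  -- Take `s = t = 1`: since `2^n = 2` and `m = 2n`, the last relation becomes `4β = 2β + αγ`.
  have hβ : (α ≠ 0 ∨ γ ≠ 0) → 2 * β = α * γ := by
    intro hαγ
    have hmn : m = 2 * n := hαγ.elim hα hγ
    have hn2 : (2 : k) ^ n = 2 := by
      rcases hαγ with h0 | h0
      · have := mul_left_cancel₀ h0 (hrel 1 1).1
        rw [one_pow] at this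
        convert this using 1 <;> norm_num
      · have := mul_left_cancel₀ h0 (hrel 1 1).2.1
        rw [one_pow] at this
        convert this using 1 <;> norm_num
    have := (hrel 1 1).2.2
    rw [hmn, mul_comm 2 n, pow_mul, show (1 : k) + 1 = 2 by norm_num, hn2] at this
    simp only [one_pow, pow_mul] at this
    linear_combination this
  have hp2 : (2 : k) = 0 → p = 2 := by
    intro h2
    have : ((2 : ℕ) : k) = 0 := by exact_mod_cast h2
    exact (Nat.prime_dvd_prime_iff_eq Fact.out Nat.prime_two).1
      ((CharP.cast_eq_zero_iff k p 2).1 this)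
  by_cases hα0 : α = 0
  · have hβ0 : β ≠ 0 := by simpa [hα0] using hne
    subst hα0
    by_cases hγ0 : γ = 0
    · subst hγ0
      obtain ⟨e, he⟩ := exists_eq_pow_of_add_pow (k := k) p hm fun s t => by
        have := (hrel s t).2.2
        simpa [hβ0] using this
      -- With `α = γ = 0` the exponent `n` is immaterial and is reset to the `0` used in the data of
      -- form (IV).
      have h' : HasShape φ ⟨m, 0, 0, β, 0⟩ := fun g => by rw [h g]; simp
      refine ⟨![1, 1, (Units.mk0 β hβ0)⁻¹], .IV, e, trivial, ?_⟩
      have := h'.conj ![1, 1, (Units.mk0 β hβ0)⁻¹]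
      simpa [SharpForm.data, hβ0, he] using this
    · obtain ⟨e, hn, hm⟩ := hpow (Or.inr hγ0)
      have h2 : p = 2 := hp2 (by simpa [hβ0] using hβ (Or.inr hγ0))
      -- Conjugation by `c` turns `α, β, γ` into `α c₁/c₀`, `β c₂/c₀`, `γ c₂/c₁`; with `c₀ = 1`, `c`
      -- is solved so that `β` and `γ` become `1`.
      refine ⟨![1, Units.mk0 γ hγ0 * (Units.mk0 β hβ0)⁻¹, (Units.mk0 β hβ0)⁻¹], .VII, e, h2, ?_⟩
      have := h.conj ![1, Units.mk0 γ hγ0 * (Units.mk0 β hβ0)⁻¹, (Units.mk0 β hβ0)⁻¹]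
      simpa [SharpForm.data, hβ0, hγ0, hn, hm] using this
  · obtain ⟨e, hn, hm⟩ := hpow (Or.inl hα0)
    have h2β := hβ (Or.inl hα0)
    by_cases hγ0 : γ = 0
    · subst hγ0
      have hβ0 : β ≠ 0 := by simpa using hne
      have h2 : p = 2 := hp2 (by simpa [hβ0] using h2β)
      refine ⟨![1, (Units.mk0 α hα0)⁻¹, (Units.mk0 β hβ0)⁻¹], .V, e, h2, ?_⟩
      have := h.conj ![1, (Units.mk0 α hα0)⁻¹, (Units.mk0 β hβ0)⁻¹]
      simpa [SharpForm.data, hβ0, hα0, hn, hm] using this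
    · have h20 : (2 : k) ≠ 0 := fun h2 => mul_ne_zero hα0 hγ0 (by rw [← h2β, h2, zero_mul])
      have hp3 : 3 ≤ p := by
        have h1 := (Fact.out : p.Prime).two_le
        have h2 : p ≠ 2 := by
          rintro rfl
          exact h20 (by exact_mod_cast CharP.cast_eq_zero k 2)
        omega
      -- Scaling `α` and `γ` to `1` leaves no freedom for `β`, which becomes `β/(αγ) = 1/2`.
      refine ⟨![1, (Units.mk0 α hα0)⁻¹, (Units.mk0 α hα0)⁻¹ * (Units.mk0 γ hγ0)⁻¹], .I, e, hp3, ?_⟩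
      have := h.conj ![1, (Units.mk0 α hα0)⁻¹, (Units.mk0 α hα0)⁻¹ * (Units.mk0 γ hγ0)⁻¹]
      have e1 : β * (α⁻¹ * γ⁻¹) = 2⁻¹ := by
        field_simp
        linear_combination h2β
      have e2 : α * γ * (α⁻¹ * γ⁻¹) = 1 := by
        field_simp
      simpa [SharpForm.data, hα0, hγ0, hn, hm, e1, e2] using this

theorem IsFundamental.exists_sharp {k : Type*} [Field k] [IsAlgClosed k] (p : ℕ) [Fact p.Prime]
    [CharP k p] {φ : AlgRep (regularGaGm k) 3} (h : IsFundamental φ) :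
    ∃ (P : Matrix.GeneralLinearGroup (Fin 3) k) (lam : SharpForm),
      HasSharpForm p (φ.conj P) lam := by
  obtain ⟨ψ, hψ⟩ := h
  have : Infinite k := IsAlgClosed.instInfinite
  obtain ⟨P, m, hw⟩ := exists_conj_torus_eq_diagonal ψ
  have hφ := IsFundamental.conj hψ P
  by_cases hm : m = 0
  · subst hm
    refine ⟨P, .XII, (hasSharpForm_iff _ _ _).2 ⟨trivial, 0,
      HasShape.of_torus_upper (D := ⟨0, 0, 0, 0, 0⟩) hφ hw fun t => ?_⟩⟩
    -- When all weights coincide, `upper_diag` covers every entry, so the unipotents act trivially.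
    have hw0 : ∀ i, weights 0 i = 0 := fun i => by fin_cases i <;> simp [weights]
    ext i j
    rw [upper_diag _ _ hw i j (by rw [hw0, hw0]) t]
    fin_cases i <;> fin_cases j <;> simp
  · obtain ⟨n, α, β, γ, hU, hα, hγ⟩ := exists_upper_eq _ hm hw
    obtain ⟨c, lam, e, hlam, hs⟩ := HasShape.exists_sharp p
      (HasShape.of_torus_upper (D := ⟨m, n, α, β, γ⟩) hφ hw hU) hm hα hγ
      (mul_ne_zero_or_ne_zero _ hm hw hU) (upper_relations _ hU)
    rw [AlgRep.conj_conj] at hs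
    exact ⟨_, lam, (hasSharpForm_iff _ _ _).2 ⟨hlam, e, hs⟩⟩

/-- Only (XII) has `m = 0`, and the other four forms have different vanishing patterns of `(α, γ)`;
within a form, `m` fixes `p ^ e`. The pattern is essential: for `p = 2`, (IV) with exponent `e + 1`
has the same `m` as (V) and (VII) with exponent `e`. -/
theorem SharpForm.eq_of_data {k : Type*} [Field k] (p : ℕ) [Fact p.Prime]
    {lam lam' : SharpForm} {e e' : ℕ} (hl : lam.Allowed p) (hl' : lam'.Allowed p)
    (hm : (lam.data k p e).m = (lam'.data k p e').m)
    (hc : (lam.data k p e).m ≠ 0 → ((lam.data k p e).α = 0 ↔ (lam'.data k p e').α = 0) ∧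
      ((lam.data k p e).γ = 0 ↔ (lam'.data k p e').γ = 0)) :
    lam = lam' ∧ lam.data k p e = lam'.data k p e' := by
  have hp := (Fact.out : p.Prime)
  have hpe : p ^ e ≠ 0 := pow_ne_zero _ hp.ne_zero
  have hpe' : p ^ e' ≠ 0 := pow_ne_zero _ hp.ne_zero
  cases lam <;> cases lam' <;> simp [data, Allowed, hp.ne_zero] at hl hl' hm hc ⊢ <;>
    first
    | exact hm
    | omega

end GaGmSL3

theorem corollary3p13 (k : Type*) [Field k] [IsAlgClosed k] (p : ℕ) [Fact p.Prime] [CharP k p] :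
    Function.Bijective (GaGmSL3.sharpToClass k p) := by
  have : Infinite k := IsAlgClosed.instInfinite
  constructor
  · rintro ⟨lam, φ, hφ, hs⟩ ⟨lam', φ', hφ', hs'⟩ h
    have heq : φ.Equivalent φ' := Quotient.exact h
    obtain ⟨hl, e, hD⟩ := (GaGmSL3.hasSharpForm_iff _ _ _).1 hs
    obtain ⟨hl', e', hD'⟩ := (GaGmSL3.hasSharpForm_iff _ _ _).1 hs'
    obtain ⟨rfl, hdata⟩ := GaGmSL3.SharpForm.eq_of_data p hl hl' (hD.m_eq hD' heq)
      (hD.coeff_eq_zero_iff hD' heq)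
    obtain rfl := hD.eq (hdata ▸ hD')
    rfl
  · intro q
    obtain ⟨⟨φ, hφ⟩, rfl⟩ := Quotient.exists_rep q
    obtain ⟨P, lam, hs⟩ := hφ.exists_sharp p
    obtain ⟨ψ, hψ⟩ := hφ
    -- Conjugating the extension `ψ` by the same `P` keeps the normalized representative
    -- fundamental.
    refine ⟨⟨lam, φ.conj P, ⟨ψ.conj P, GaGmSL3.IsFundamental.conj hψ P⟩, hs⟩, Quotient.sound ?_⟩
    exact (GaGmSL3.AlgRep.equivalent_equivalence _ _).symm (φ.equivalent_conj P)
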